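/- A half-edge ribbon graph (HERG) $G_H=G(V,E,H)$ is a finite ribbon graph $G(V,E)$ (vertex discs joined by ribbon edges, not necessarily orientable or connected) together with a finite set $H$ of half-ribbons; a half-ribbon is a rectangle glued along one of its sides to a vertex disc, and the opposite side is its external segment. A boundary component of $G_H$ is an external cycle if it contains the external segment of some half-ribbon, and a closed face otherwise; $C_{\rm ext}(G_H)$ and $f_{\rm int}(G_H)$ denote the numbers of external cycles and of closed faces. Cutting an edge means removing it and inserting two half-ribbons, one at each of the two places where the edge was attached; $G_H\vee S$ is the result of cutting all edges of $S\subseteq E$. The HERGs $A=G_H\vee S$, $S\subseteq E$, are the spanning cutting subgraphs of $G_H$, written $A\Subset G_H$. The geometric dual $G_H^*$ is the HERG of the geometric dual of the embedding of $G_H$ in the punctured surface with one puncture for each half-ribbon: its vertices are the boundary components of $G_H$, each ribbon edge becomes the same rectangle attached along its other two sides, and each half-ribbon is attached to the vertex given by the external cycle that contains it, at the place where this cycle runs around the half-ribbon. In $\mathbb{Z}[a,b]/\langle b^2-ab\rangle$ put $$\mathcal{P}_{G_H}(a,b)=\sum_{A\Subset G_H}a^{f_{\rm int}(A)}b^{C_{\rm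 ext}(A)},\qquad M_{G_H}(a,b)=\sum_{A\in\{G_H\vee E,\;G_H\}}a^{f_{\rm int}(A)}b^{C_{\rm ext}(A)}.$$ Since $a^nb^m=b^{n+m}$ for $m>0$, every element $F(a,b)$ of this ring is a $\mathbb{Z}$-linear combination, in exactly one way, of the powers $a^n$ ($n\ge 0$) and $b^m$ ($m\ge 1$); $F(b,a)$ denotes the element obtained by exchanging $a$ and $b$ in this expression. Proposition. Let $G_H$ be a HERG. (1) If $C_{\rm ext}(G_H)>0$, then $M_{G_H}(a,b)=M_{G_H^*}(a,b)$ and $\mathcal{P}_{G_H}(a,b)=\mathcal{P}_{G_H^*}(a,b)$. (2) If $C_{\rm ext}(G_H)=0$, then $\mathcal{P}_{G_H}(a,b)-M_{G_H}(a,b)=\mathcal{P}_{G_H^*}(a,b)-M_{G_H^*}(a,b)$; if moreover $G_H$ has at least one edge, then $M_{G_H}(a,b)=M_{G_H^*}(b,a)$. -/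

import Mathlib

universe u

noncomputable section

/-! ## Half-edge ribbon graphs (HERGs)

A ribbon edge `e` is a rectangle.  Two opposite sides of it, the *ends* `i : Bool`, are glued to
vertex discs; each end is a segment with two endpoints `s : Bool`, numbered so that, for fixed `s`,
the points `(e, false, s)` and `(e, true, s)` are joined by a free side of the rectangle.
A half-ribbon (HR) `h` is a rectangle which has one side glued to a vertex disc, with endpoints
`(h, false)`, `(h, true)`; the side of the rectangle opposite to it is its external segment.
These marked points on the boundaries of the vertex discs are the *flags*. -/

/-- The flags: four for each ribbon edge, two for each half-ribbon. -/
abbrev RFlag (E H : Type u) : Type u := (E × Bool × Bool) ⊕ (H × Bool)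

/-- The other endpoint of the segment along which the ribbon or half-ribbon is glued to a vertex. -/
def segFlip {E H : Type u} : RFlag E H → RFlag E H
  | .inl (e, i, s) => .inl (e, i, !s)
  | .inr (h, s) => .inr (h, !s)

/-- The flag which is reached when one follows the part of the boundary of the ribbon or of the
half-ribbon that is not glued to a vertex disc: a free side of a ribbon edge, or, for a half-ribbon,
a side, the external segment, and the other side. -/
def sideFlip {E H : Type u} : RFlag E H → RFlag E H
  | .inl (e, i, s) => .inl (e, !i, s)
  | .inr (h, s) => .inr (h, !s)

/-- The flags which belong to half-ribbons. -/
def IsHRFlag {E H : Type u} (x : RFlag E H) : Prop := ∃ h s, x = .inr (h, s)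

/-- The equivalence relation "`y` is reached from `x` by following `f` and `g`". -/
def orbitSetoid {X : Type u} (f g : X → X) : Setoid X :=
  Relation.EqvGen.setoid (fun x y => y = f x ∨ y = g x)

theorem orbitSetoid_conj {X Y : Type u} (e : X ≃ Y) (f g : X → X) (f' g' : Y → Y)
    (hf : ∀ y, e.symm (f' y) = f (e.symm y)) (hg : ∀ y, e.symm (g' y) = g (e.symm y)) (x y : Y) :
    (orbitSetoid f' g').r x y ↔ (orbitSetoid f g).r (e.symm x) (e.symm y) := by
  constructor
  · intro h
    change Relation.EqvGen _ _ _
    induction h with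
    | rel a b hab =>
      refine Relation.EqvGen.rel _ _ ?_
      rcases hab with rfl | rfl
      · exact Or.inl (hf a)
      · exact Or.inr (hg a)
    | refl a => exact Relation.EqvGen.refl _
    | symm a b _ ih => exact Relation.EqvGen.symm _ _ ih
    | trans a b c _ _ ih1 ih2 => exact Relation.EqvGen.trans _ _ _ ih1 ih2
  · intro h
    have key : ∀ a b : X, Relation.EqvGen (fun x y => y = f x ∨ y = g x) a b →
        Relation.EqvGen (fun x y => y = f' x ∨ y = g' x) (e a) (e b) := by
      intro a b hab
      induction hab with
      | rel a b hab =>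
        refine Relation.EqvGen.rel _ _ ?_
        rcases hab with rfl | rfl
        · left; apply e.symm.injective; rw [hf]; simp
        · right; apply e.symm.injective; rw [hg]; simp
      | refl a => exact Relation.EqvGen.refl _
      | symm a b _ ih => exact Relation.EqvGen.symm _ _ ih
      | trans a b c _ _ ih1 ih2 => exact Relation.EqvGen.trans _ _ _ ih1 ih2
    have := key _ _ h
    simp only [Equiv.apply_symm_apply] at this
    exact this

/-- A (finite, not necessarily orientable, not necessarily connected) half-edge ribbon graph
`G(V, E, H)`, given by the gluing data of its vertex discs, ribbon edges and half-ribbons.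

`corner` joins two flags when they are the ends of one of the arcs into which the glued segments
cut the boundary circles of the vertex discs.  `vert` gives the vertex disc on which a flag lies;
as a vertex is a disc, its boundary is one circle, which alternates glued segments and corner arcs.
A vertex outside the range of `vert` is a disc to which nothing is glued. -/
structure HERG where
  V : Type u
  E : Type u
  H : Type u
  finite_V : Finite V
  fintype_E : Fintype E
  finite_H : Finite H
  corner : RFlag E H → RFlag E H
  corner_corner : ∀ x, corner (corner x) = x
  corner_ne : ∀ x, corner x ≠ x
  vert : RFlag E H → V
  vert_eq_iff : ∀ x y, vert x = vert y ↔ (orbitSetoid segFlip corner).r x y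

namespace HERG

instance (G : HERG.{u}) : Finite G.V := G.finite_V
instance (G : HERG.{u}) : Fintype G.E := G.fintype_E
instance (G : HERG.{u}) : Finite G.H := G.finite_H

/-- The vertex discs to which nothing is glued. -/
abbrev BareVertex (G : HERG.{u}) : Type u := {v : G.V // ∀ x, G.vert x ≠ v}

/-- The boundary circles of the surface `G` which contain flags: follow in turn corner arcs and
free parts of the boundaries of ribbons and half-ribbons. -/
abbrev BoundaryCircle (G : HERG.{u}) : Type u := Quotient (orbitSetoid G.corner sideFlip)

/-- All boundary components of the surface `G`; the boundary of a vertex disc to which nothing is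
glued is one of them. -/
abbrev BoundaryComponent (G : HERG.{u}) : Type u := G.BoundaryCircle ⊕ G.BareVertex

/-- A boundary component is an external cycle if it runs through the external segment of some
half-ribbon. -/
def IsExternalCycle (G : HERG.{u}) : G.BoundaryComponent → Prop
  | .inl c => ∃ x, IsHRFlag x ∧ Quotient.mk (orbitSetoid G.corner sideFlip) x = c
  | .inr _ => False

/-- The number of closed faces: boundary components that meet no external segment. -/
def fInt (G : HERG.{u}) : ℕ := Nat.card {c : G.BoundaryComponent // ¬ G.IsExternalCycle c}

/-- The number of external cycles. -/
def cExt (G : HERG.{u}) : ℕ := Nat.card {c : G.BoundaryComponent // G.IsExternalCycle c}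

/-! ### Spanning cutting subgraphs -/

open Classical in
/-- Cutting the ribbon edges outside `A`: each end of such an edge becomes a half-ribbon. -/
def cutFlag {E H : Type u} (A : Finset E) :
    RFlag E H ≃ RFlag {e // e ∈ A} (H ⊕ ({e // e ∉ A} × Bool)) where
  toFun
    | .inl (e, i, s) => if h : e ∈ A then .inl (⟨e, h⟩, i, s) else .inr (.inr (⟨e, h⟩, i), s)
    | .inr (h, s) => .inr (.inl h, s)
  invFun
    | .inl (e, i, s) => .inl (e.1, i, s)
    | .inr (.inl h, s) => .inr (h, s)
    | .inr (.inr (e, i), s) => .inl (e.1, i, s)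
  left_inv := by
    rintro (⟨e, i, s⟩ | ⟨h, s⟩)
    · by_cases he : e ∈ A <;> simp [he]
    · rfl
  right_inv := by
    rintro (⟨⟨e, he⟩, i, s⟩ | ⟨h | ⟨⟨e, he⟩, i⟩, s⟩)
    · simp [he]
    · rfl
    · simp [he]

/-- The spanning cutting subgraph of `G` with edge set `A`: all vertices and half-ribbons of `G` are
kept, and every edge outside `A` is cut, that is, removed and replaced by two half-ribbons, one at
each of the two places where it was glued.  So `G.cutTo Finset.univ` is `G` and `G.cutTo ∅` is
`G ∨ E(G)`. -/
def cutTo (G : HERG.{u}) (A : Finset G.E) : HERG.{u} where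
  V := G.V
  E := {e // e ∈ A}
  H := G.H ⊕ ({e // e ∉ A} × Bool)
  finite_V := inferInstance
  fintype_E := inferInstance
  finite_H := inferInstance
  corner x := cutFlag A (G.corner ((cutFlag A).symm x))
  corner_corner x := by simp [G.corner_corner]
  corner_ne x := by
    rw [Ne, ← (cutFlag A).eq_symm_apply]
    exact G.corner_ne _
  vert x := G.vert ((cutFlag A).symm x)
  vert_eq_iff x y := by
    rw [G.vert_eq_iff]
    refine (orbitSetoid_conj (cutFlag A) _ _ _ _ ?_ ?_ x y).symm
    · rintro (⟨⟨e, he⟩, i, s⟩ | ⟨h | ⟨⟨e, he⟩, i⟩, s⟩) <;> rfl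
    · intro y; simp

/-! ### The geometric dual -/

/-- Exchange the two pairs of opposite sides of every ribbon edge, and keep the half-ribbons. -/
def turnFlag {E H : Type u} : RFlag E H ≃ RFlag E H where
  toFun
    | .inl (e, i, s) => .inl (e, s, i)
    | .inr (h, s) => .inr (h, s)
  invFun
    | .inl (e, i, s) => .inl (e, s, i)
    | .inr (h, s) => .inr (h, s)
  left_inv := by rintro (⟨e, i, s⟩ | ⟨h, s⟩) <;> rfl
  right_inv := by rintro (⟨e, i, s⟩ | ⟨h, s⟩) <;> rfl

/-- The geometric dual of `G`, for the embedding of `G` in the punctured surface that has one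
puncture for each half-ribbon.

The dual has one vertex in each face of the cellulation by the underlying ribbon graph, that is,
for each boundary component of `G`.  The dual ribbon of an edge is the same rectangle, glued along
its other two sides.  The half-edge `h` of `G` ends at a puncture; in the dual of the completed graph
the edge dual to `h` is a loop around this puncture, based at the vertex in the external cycle that
contains `h`.  Grafting replaces this loop by one half-edge from that vertex to the puncture, in the
same place of the cyclic order: it sits where the external cycle runs around `h`, between the
same two corners. -/
def dual (G : HERG.{u}) : HERG.{u} where
  V := G.BoundaryComponent
  E := G.E
  H := G.H
  finite_V := inferInstance
  fintype_E := inferInstance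
  finite_H := inferInstance
  corner x := turnFlag (G.corner (turnFlag.symm x))
  corner_corner x := by simp [G.corner_corner]
  corner_ne x := by
    rw [Ne, ← turnFlag.eq_symm_apply]
    exact G.corner_ne _
  vert x := .inl (Quotient.mk _ (turnFlag.symm x))
  vert_eq_iff x y := by
    rw [Sum.inl.injEq, Quotient.eq]
    refine Iff.trans ?_ (orbitSetoid_conj turnFlag sideFlip G.corner _ _ ?_ ?_ x y).symm
    · have : (fun x y => y = G.corner x ∨ y = sideFlip x) =
          (fun x y : RFlag G.E G.H => y = sideFlip x ∨ y = G.corner x) := by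
        funext x y; exact propext or_comm
      change Relation.EqvGen _ _ _ ↔ Relation.EqvGen _ _ _
      rw [this]
    · rintro (⟨e, i, s⟩ | ⟨h, s⟩) <;> rfl
    · intro y; simp

end HERG

/-! ## The ring `ℤ[a, b] / (b² - a b)` -/

/-- `ℤ[a, b]`, with `a = X 0` and `b = X 1`. -/
abbrev PolyAB : Type := MvPolynomial (Fin 2) ℤ

/-- The ideal generated by `b² - a b`. -/
def idealAB : Ideal PolyAB :=
  Ideal.span {MvPolynomial.X 1 ^ 2 - MvPolynomial.X 0 * MvPolynomial.X 1}

/-- `ℤ[a, b] / (b² - a b)`. -/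
abbrev QuotAB : Type := PolyAB ⧸ idealAB

/-- The class of the variable `a`. -/
def varA : QuotAB := Ideal.Quotient.mk idealAB (MvPolynomial.X 0)

/-- The class of the variable `b`. -/
def varB : QuotAB := Ideal.Quotient.mk idealAB (MvPolynomial.X 1)

/-- The substitution `a ↦ t`, `b ↦ 0`. -/
def substZero : QuotAB →+* Polynomial ℤ :=
  Ideal.Quotient.lift idealAB
    (MvPolynomial.aeval (R := ℤ) ![(Polynomial.X : Polynomial ℤ), 0]).toRingHom (by
      intro p hp
      have : idealAB ≤ RingHom.ker
          (MvPolynomial.aeval (R := ℤ) ![(Polynomial.X : Polynomial ℤ), 0]).toRingHom := by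
        rw [idealAB, Ideal.span_singleton_le_iff_mem, RingHom.mem_ker]
        simp
      exact this hp)

/-- The substitution `a ↦ t`, `b ↦ t`. -/
def substDiag : QuotAB →+* Polynomial ℤ :=
  Ideal.Quotient.lift idealAB
    (MvPolynomial.aeval (R := ℤ) ![(Polynomial.X : Polynomial ℤ), Polynomial.X]).toRingHom (by
      intro p hp
      have : idealAB ≤ RingHom.ker
          (MvPolynomial.aeval (R := ℤ) ![(Polynomial.X : Polynomial ℤ), Polynomial.X]).toRingHom := by
        rw [idealAB, Ideal.span_singleton_le_iff_mem, RingHom.mem_ker]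
        simp [sq]
      exact this hp)

/-- A polynomial is reduced if each of its monomials is a power of `a` or a power of `b`. -/
def IsReducedAB (p : PolyAB) : Prop := ∀ m ∈ p.support, m 0 = 0 ∨ m 1 = 0

/-- The reduced form of an element of `ℤ[a, b] / (b² - a b)`, obtained by means of
`aⁿ bᵐ = bⁿ⁺ᵐ` for `m > 0`: if `p(a, b)` represents the element, this is
`p(a, 0) + (p(b, b) - p(b, 0))`.  By `existsUnique_reduced` it is the only reduced representative. -/
def reducedForm (x : QuotAB) : PolyAB :=
  Polynomial.aeval (MvPolynomial.X 0) (substZero x) +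
    Polynomial.aeval (MvPolynomial.X 1) (substDiag x - substZero x)

theorem reducedForm_add (x y : QuotAB) : reducedForm (x + y) = reducedForm x + reducedForm y := by
  simp only [reducedForm, map_add, map_sub]; ring

theorem varA_mul_varB : varB ^ 2 = varA * varB := by
  rw [varA, varB, ← map_pow, ← map_mul, Ideal.Quotient.eq]
  exact Ideal.subset_span rfl

theorem pow_varA_mul_pow_varB (n m : ℕ) : varA ^ n * varB ^ (m + 1) = varB ^ (n + (m + 1)) := by
  induction n with
  | zero => simp
  | succ n ih =>
    calc varA ^ (n + 1) * varB ^ (m + 1) = varA * (varA ^ n * varB ^ (m + 1)) := by ring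
      _ = (varA * varB) * varB ^ (n + m) := by rw [ih]; ring
      _ = varB ^ (n + 1 + (m + 1)) := by rw [← varA_mul_varB]; ring

theorem reducedForm_monomial (m : Fin 2 →₀ ℕ) (c : ℤ) :
    reducedForm (Ideal.Quotient.mk idealAB (MvPolynomial.monomial m c)) =
      if m 1 = 0 then MvPolynomial.C c * MvPolynomial.X 0 ^ m 0
      else MvPolynomial.C c * MvPolynomial.X 1 ^ (m 0 + m 1) := by
  have h0 : substZero (Ideal.Quotient.mk idealAB (MvPolynomial.monomial m c)) =
      Polynomial.C c * (Polynomial.X ^ m 0 * 0 ^ m 1) := by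
    simp [substZero, MvPolynomial.aeval_monomial, Finsupp.prod_fintype]
  have h1 : substDiag (Ideal.Quotient.mk idealAB (MvPolynomial.monomial m c)) =
      Polynomial.C c * (Polynomial.X ^ m 0 * Polynomial.X ^ m 1) := by
    simp [substDiag, MvPolynomial.aeval_monomial, Finsupp.prod_fintype]
  rw [reducedForm, h0, h1]
  split_ifs with h
  · simp [h]
  · simp [h, pow_add]

theorem monomial_eq_two (m : Fin 2 →₀ ℕ) (c : ℤ) : (MvPolynomial.monomial m c : PolyAB) =
    MvPolynomial.C c * (MvPolynomial.X 0 ^ m 0 * MvPolynomial.X 1 ^ m 1) := by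
  rw [MvPolynomial.monomial_eq, Finsupp.prod_fintype _ _ (by simp)]
  simp

theorem mk_reducedForm (x : QuotAB) : Ideal.Quotient.mk idealAB (reducedForm x) = x := by
  obtain ⟨p, rfl⟩ := Ideal.Quotient.mk_surjective x
  induction p using MvPolynomial.induction_on' with
  | monomial m c =>
    rw [reducedForm_monomial, monomial_eq_two]
    split_ifs with h
    · simp [h]
    · obtain ⟨k, hk⟩ := Nat.exists_eq_succ_of_ne_zero h
      have := pow_varA_mul_pow_varB (m 0) k
      simp only [varA, varB] at this
      simp only [map_mul, map_pow, hk, Nat.succ_eq_add_one, this]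
  | add p q hp hq => rw [map_add, reducedForm_add, map_add, hp, hq]

theorem IsReducedAB.add {p q : PolyAB} (hp : IsReducedAB p) (hq : IsReducedAB q) :
    IsReducedAB (p + q) := by
  classical
  intro m hm
  rcases Finset.mem_union.1 (MvPolynomial.support_add hm) with h | h
  · exact hp m h
  · exact hq m h

theorem isReducedAB_reducedForm (x : QuotAB) : IsReducedAB (reducedForm x) := by
  obtain ⟨p, rfl⟩ := Ideal.Quotient.mk_surjective x
  induction p using MvPolynomial.induction_on' with
  | monomial m c =>
    rw [reducedForm_monomial]
    split_ifs with h
    · intro k hk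
      rw [MvPolynomial.X_pow_eq_monomial, MvPolynomial.C_mul_monomial] at hk
      have := Finset.mem_singleton.1 (MvPolynomial.support_monomial_subset hk)
      right; simp [this]
    · intro k hk
      rw [MvPolynomial.X_pow_eq_monomial, MvPolynomial.C_mul_monomial] at hk
      have := Finset.mem_singleton.1 (MvPolynomial.support_monomial_subset hk)
      left; simp [this]
  | add p q hp hq => rw [map_add, reducedForm_add]; exact hp.add hq

theorem IsReducedAB.reducedForm_mk {p : PolyAB} (hp : IsReducedAB p) :
    reducedForm (Ideal.Quotient.mk idealAB p) = p := by
  have hadd : ∀ s : Finset (Fin 2 →₀ ℕ),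
      reducedForm (Ideal.Quotient.mk idealAB (∑ m ∈ s, MvPolynomial.monomial m (p.coeff m))) =
      ∑ m ∈ s, reducedForm (Ideal.Quotient.mk idealAB (MvPolynomial.monomial m (p.coeff m))) := by
    classical
    intro s
    induction s using Finset.induction_on with
    | empty => simp [reducedForm]
    | insert a s ha ih => rw [Finset.sum_insert ha, Finset.sum_insert ha, map_add,
        reducedForm_add, ih]
  have h := hadd p.support
  rw [← MvPolynomial.as_sum p] at h
  rw [h]
  conv_rhs => rw [MvPolynomial.as_sum p]
  refine Finset.sum_congr rfl fun m hm => ?_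
  rw [reducedForm_monomial, monomial_eq_two]
  split_ifs with h1
  · simp [h1]
  · have h0 := (hp m hm).resolve_right h1
    rw [h0]; simp

/-- Each element of `ℤ[a, b] / (b² - a b)` has exactly one reduced representative. -/
theorem existsUnique_reduced (x : QuotAB) :
    ∃! p : PolyAB, IsReducedAB p ∧ Ideal.Quotient.mk idealAB p = x :=
  ⟨reducedForm x, ⟨isReducedAB_reducedForm x, mk_reducedForm x⟩, by
    rintro p ⟨hp, rfl⟩; exact hp.reducedForm_mk.symm⟩

/-- `F(a, b) ↦ F(b, a)`.  As the exchange of `a` and `b` does not preserve the ideal, it is carried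
out on the reduced form of `F`: every `aⁿ` becomes `bⁿ` and every `bⁿ` becomes `aⁿ`. -/
def swapAB (x : QuotAB) : QuotAB :=
  Ideal.Quotient.mk idealAB (MvPolynomial.rename (Equiv.swap 0 1) (reducedForm x))

/-! ## The polynomials -/

namespace HERG

/-- The contribution `a ^ f_int(A) * b ^ C_ext(A)` of a HERG `A`. -/
def weight (A : HERG.{u}) : QuotAB := varA ^ A.fInt * varB ^ A.cExt

/-- The polynomial `𝓟_G(a, b)`: the sum over all spanning cutting subgraphs. -/
def cutPoly (G : HERG.{u}) : QuotAB := ∑ A : Finset G.E, (G.cutTo A).weight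

open Classical in
/-- `M_G(a, b)`: the sum over the two spanning cutting subgraphs `G ∨ E(G)` and `G` (which coincide
if `G` has no edges). -/
def cutPolyM (G : HERG.{u}) : QuotAB :=
  ∑ A ∈ ({∅, Finset.univ} : Finset (Finset G.E)), (G.cutTo A).weight

end HERG

end

/-!
In `ℤ[a, b] / (b² - a b)` the contribution of a HERG depends only on its number `t` of boundary
components and on whether it has a half-ribbon: it is `bᵗ` if it has one, since then there is an
external cycle, and `aᵗ` otherwise (`HERG.weight_eq_varB_pow`, `HERG.weight_eq_varA_pow`).

The number `t` is compatible with duality: the boundary of the spanning cutting subgraph of `G` with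
edge set `A` and the boundary of the one of `G.dual` with the complementary edge set are the same
circles.  Indeed, a cut rectangle of `G` is run along at the two sides where it was glued in
`G`, which are the free sides of the same rectangle in the dual, and vice versa
(`HERG.card_boundaryComponent_dual_cutTo_compl`).

So the contributions of `A` and of its complement agree as soon as both HERGs have half-ribbons,
which only fails if `G` has none and `A` is empty or everything.  Taking complements permutes the
edge sets and preserves `{∅, univ}`, so the sums agree; in the exceptional case the two terms of
the `M`-polynomials are a power of `a` and a power of `b`, which duality exchanges.
-/

theorem swapAB_add (x y : QuotAB) : swapAB (x + y) = swapAB x + swapAB y := by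
  simp [swapAB, reducedForm_add]

theorem swapAB_varA_pow (n : ℕ) : swapAB (varA ^ n) = varB ^ n := by
  have h : reducedForm (varA ^ n) = MvPolynomial.X 0 ^ n := by
    simp [reducedForm, varA, substZero, substDiag]
  simp [swapAB, h, varB]

theorem swapAB_varB_pow {n : ℕ} (hn : n ≠ 0) : swapAB (varB ^ n) = varA ^ n := by
  have h : reducedForm (varB ^ n) = MvPolynomial.X 1 ^ n := by
    simp [reducedForm, varB, substZero, substDiag, hn]
  simp [swapAB, h, varA]

namespace HERG

theorem fInt_add_cExt (G : HERG.{u}) : G.fInt + G.cExt = Nat.card G.BoundaryComponent := by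
  classical
  rw [fInt, cExt, add_comm, ← Nat.card_sum]
  exact Nat.card_congr (Equiv.sumCompl _)

theorem cExt_pos_iff (G : HERG.{u}) : 0 < G.cExt ↔ Nonempty G.H := by
  rw [cExt, Nat.card_pos_iff]
  constructor
  · rintro ⟨⟨⟨c | v, hc⟩⟩, -⟩
    · obtain ⟨x, ⟨h, -, -⟩, -⟩ := hc
      exact ⟨h⟩
    · exact hc.elim
  · rintro ⟨h⟩
    exact ⟨⟨⟨.inl (Quotient.mk _ (.inr (h, false))), _, ⟨h, false, rfl⟩, rfl⟩⟩, inferInstance⟩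

theorem weight_eq_varB_pow (G : HERG.{u}) (h : Nonempty G.H) :
    G.weight = varB ^ Nat.card G.BoundaryComponent := by
  obtain ⟨k, hk⟩ := Nat.exists_eq_succ_of_ne_zero (G.cExt_pos_iff.2 h).ne'
  rw [weight, ← fInt_add_cExt, hk, Nat.succ_eq_add_one, pow_varA_mul_pow_varB]

theorem weight_eq_varA_pow (G : HERG.{u}) (h : IsEmpty G.H) :
    G.weight = varA ^ Nat.card G.BoundaryComponent := by
  have h0 : G.cExt = 0 := by
    rwa [← Nat.le_zero, ← not_lt, cExt_pos_iff, not_nonempty_iff]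
  rw [weight, ← fInt_add_cExt, h0, pow_zero, mul_one, add_zero]

theorem nonempty_H_cutTo_iff (G : HERG.{u}) (A : Finset G.E) :
    Nonempty (G.cutTo A).H ↔ Nonempty G.H ∨ A ≠ Finset.univ := by
  change Nonempty (G.H ⊕ ({e // e ∉ A} × Bool)) ↔ _
  simp [Finset.ext_iff, (⟨true⟩ : Nonempty Bool)]

/-- The bare vertices are not affected by cutting edges. -/
def bareVertexCutTo (G : HERG.{u}) (A : Finset G.E) : (G.cutTo A).BareVertex ≃ G.BareVertex :=
  Equiv.subtypeEquivRight fun _ =>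
    (cutFlag (H := G.H) A).symm.forall_congr fun _ => Iff.rfl

theorem exists_dual_vert_eq_inl (G : HERG.{u}) (c : G.BoundaryCircle) :
    ∃ x, G.dual.vert x = .inl c := by
  obtain ⟨x, rfl⟩ := Quotient.exists_rep c
  exact ⟨turnFlag x, congrArg (fun y => Sum.inl (Quotient.mk _ y)) (turnFlag.symm_apply_apply x)⟩

/-- The bare vertices of the dual are the boundary components of `G` without flags, which are the
boundaries of the bare vertices of `G`. -/
def bareVertexDual (G : HERG.{u}) : G.dual.BareVertex ≃ G.BareVertex where
  toFun
    | ⟨.inl c, hc⟩ => (not_exists.2 hc (G.exists_dual_vert_eq_inl c)).elim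
    | ⟨.inr v, _⟩ => v
  invFun v := ⟨.inr v, fun x => by simp [dual]⟩
  left_inv := by
    rintro ⟨c | v, hc⟩
    · exact (not_exists.2 hc (G.exists_dual_vert_eq_inl c)).elim
    · rfl
  right_inv _ := rfl

open Classical in
/-- In terms of the uncut flags, the boundary runs along a free side of each edge that is kept,
and around the new half-ribbon at each end of an edge that is cut. -/
theorem cutFlag_symm_sideFlip_cutFlag {E H : Type u} (A : Finset E) (e : E) (i s : Bool) :
    (cutFlag A).symm (sideFlip (cutFlag A (.inl (e, i, s) : RFlag E H))) =
      if e ∈ A then .inl (e, !i, s) else .inl (e, i, !s) := by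
  by_cases h : e ∈ A <;> simp [cutFlag, sideFlip, h]

open Classical in
/-- Turning the rectangles matches the sides of the boundary after cutting the edges outside `A`
with those after cutting the edges in `A`. -/
theorem turnFlag_symm_cut_sideFlip {E H : Type u} [Fintype E] (A : Finset E) (x : RFlag E H) :
    turnFlag.symm ((cutFlag Aᶜ).symm (sideFlip (cutFlag Aᶜ x))) =
      (cutFlag A).symm (sideFlip (cutFlag A (turnFlag.symm x))) := by
  rcases x with ⟨e, i, s⟩ | ⟨h, s⟩
  · change _ = (cutFlag A).symm (sideFlip (cutFlag A (.inl (e, s, i))))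
    rw [cutFlag_symm_sideFlip_cutFlag, cutFlag_symm_sideFlip_cutFlag]
    by_cases h : e ∈ A <;> simp [h, turnFlag]
  · rfl

open Classical in
/-- The boundary circles of a spanning cutting subgraph of the dual are those of the spanning
cutting subgraph of `G` with the complementary edge set. -/
noncomputable def boundaryCircleDualCutToCompl (G : HERG.{u}) (A : Finset G.E) :
    (G.dual.cutTo (Aᶜ : Finset G.E)).BoundaryCircle ≃ (G.cutTo A).BoundaryCircle :=
  let e : RFlag (G.cutTo A).E (G.cutTo A).H ≃
      RFlag (G.dual.cutTo (Aᶜ : Finset G.E)).E (G.dual.cutTo (Aᶜ : Finset G.E)).H :=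
    (cutFlag A).symm.trans (turnFlag.trans (cutFlag (H := G.H) (Aᶜ : Finset G.E)))
  Quotient.congr e.symm <| orbitSetoid_conj e _ _ _ _
    (fun y => by
      change cutFlag A (turnFlag.symm ((cutFlag Aᶜ).symm (cutFlag Aᶜ (turnFlag
        (G.corner (turnFlag.symm ((cutFlag (H := G.H) (Aᶜ : Finset G.E)).symm y))))))) =
        cutFlag A (G.corner ((cutFlag A).symm (cutFlag A (turnFlag.symm
          ((cutFlag (H := G.H) (Aᶜ : Finset G.E)).symm y)))))
      simp only [Equiv.symm_apply_apply])
    (fun y => by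
      obtain ⟨x, rfl⟩ := (cutFlag (H := G.H) (Aᶜ : Finset G.E)).surjective y
      change cutFlag A (turnFlag.symm ((cutFlag Aᶜ).symm (sideFlip (cutFlag Aᶜ x)))) =
        sideFlip (cutFlag A (turnFlag.symm ((cutFlag Aᶜ).symm (cutFlag Aᶜ x))))
      rw [turnFlag_symm_cut_sideFlip, Equiv.apply_symm_apply, Equiv.symm_apply_apply])

open Classical in
theorem card_boundaryComponent_dual_cutTo_compl (G : HERG.{u}) (A : Finset G.E) :
    Nat.card (G.dual.cutTo (Aᶜ : Finset G.E)).BoundaryComponent =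
      Nat.card (G.cutTo A).BoundaryComponent :=
  Nat.card_congr <| (G.boundaryCircleDualCutToCompl A).sumCongr <|
    (G.dual.bareVertexCutTo (Aᶜ : Finset G.E)).trans <|
      G.bareVertexDual.trans (G.bareVertexCutTo A).symm

open Classical in
theorem weight_dual_cutTo_compl (G : HERG.{u}) (A : Finset G.E)
    (h : Nonempty G.H ∨ A ≠ ∅ ∧ A ≠ Finset.univ) :
    (G.dual.cutTo (Aᶜ : Finset G.E)).weight = (G.cutTo A).weight := by
  rw [weight_eq_varB_pow, weight_eq_varB_pow, card_boundaryComponent_dual_cutTo_compl]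
  · exact (G.nonempty_H_cutTo_iff A).2 (h.imp_right And.right)
  · refine (G.dual.nonempty_H_cutTo_iff _).2 (h.imp_right fun h => ?_)
    exact fun h' => h.1 ((Finset.compl_eq_univ_iff A).1 h')

open Classical in
/-- Reindexing by complements a sum over a family of edge sets closed under complements. -/
theorem sum_weight_dual_cutTo (G : HERG.{u}) (S : Finset (Finset G.E))
    (hS : ∀ A ∈ S, Aᶜ ∈ S) (h : ∀ A ∈ S, Nonempty G.H ∨ A ≠ ∅ ∧ A ≠ Finset.univ) :
    ∑ A ∈ S, (G.cutTo A).weight = ∑ A ∈ S, (G.dual.cutTo A).weight :=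
  Finset.sum_bij' (fun A _ => Aᶜ) (fun A _ => Aᶜ) hS hS (fun A _ => compl_compl A)
    (fun A _ => compl_compl A) fun A hA => (G.weight_dual_cutTo_compl A (h A hA)).symm

open Classical in
theorem cutPoly_sub_cutPolyM (G : HERG.{u}) :
    G.cutPoly - G.cutPolyM =
      ∑ A ∈ ({∅, Finset.univ} : Finset (Finset G.E))ᶜ, (G.cutTo A).weight := by
  rw [cutPoly, cutPolyM, sub_eq_iff_eq_add, Finset.sum_compl_add_sum]

theorem cutPolyM_of_isEmpty (G : HERG.{u}) (hH : IsEmpty G.H) (hE : Nonempty G.E) :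
    G.cutPolyM = varB ^ Nat.card (G.cutTo ∅).BoundaryComponent +
      varA ^ Nat.card (G.cutTo Finset.univ).BoundaryComponent := by
  classical
  have hne : (∅ : Finset G.E) ≠ Finset.univ := Finset.univ_nonempty.ne_empty.symm
  rw [cutPolyM, Finset.sum_pair hne, weight_eq_varB_pow, weight_eq_varA_pow]
  · rw [← not_nonempty_iff, nonempty_H_cutTo_iff]
    simpa using hH
  · exact (G.nonempty_H_cutTo_iff _).2 (.inr hne)

theorem cutPolyM_eq_swapAB (G : HERG.{u}) (hH : IsEmpty G.H) (hE : Nonempty G.E) :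
    G.cutPolyM = swapAB G.dual.cutPolyM := by
  classical
  have h0 : Nat.card (G.dual.cutTo ∅).BoundaryComponent ≠ 0 := by
    obtain ⟨e⟩ := hE
    have : Nonempty (G.dual.cutTo ∅).BoundaryComponent :=
      ⟨.inl (Quotient.mk _ (cutFlag (∅ : Finset G.E) (.inl (e, false, false))))⟩
    exact Nat.card_pos.ne'
  have h1 := G.card_boundaryComponent_dual_cutTo_compl ∅
  have h2 := G.card_boundaryComponent_dual_cutTo_compl Finset.univ
  rw [Finset.compl_empty] at h1
  rw [Finset.compl_univ] at h2
  rw [G.cutPolyM_of_isEmpty hH hE, G.dual.cutPolyM_of_isEmpty hH hE, swapAB_add,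
    swapAB_varB_pow h0, swapAB_varA_pow, add_comm, ← h1, ← h2]
  rfl

end HERG

theorem proposition5p6 (G : HERG.{u}) :
    (0 < G.cExt → G.cutPolyM = G.dual.cutPolyM ∧ G.cutPoly = G.dual.cutPoly) ∧
    (G.cExt = 0 →
      (Nonempty G.E → G.cutPolyM = swapAB G.dual.cutPolyM) ∧
      G.cutPoly - G.cutPolyM = G.dual.cutPoly - G.dual.cutPolyM) := by
  classical
  have hpair : ∀ A ∈ ({∅, Finset.univ} : Finset (Finset G.E)),
      Aᶜ ∈ ({∅, Finset.univ} : Finset (Finset G.E)) := by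
    simp
  refine ⟨fun h => ?_, fun h => ⟨fun hE => G.cutPolyM_eq_swapAB ?_ hE, ?_⟩⟩
  · have hH := G.cExt_pos_iff.1 h
    refine ⟨?_, G.sum_weight_dual_cutTo Finset.univ (by simp) fun _ _ => .inl hH⟩
    exact G.sum_weight_dual_cutTo {∅, Finset.univ} hpair fun _ _ => .inl hH
  · rw [← not_nonempty_iff, ← G.cExt_pos_iff, h]
    exact lt_irrefl 0
  · rw [HERG.cutPoly_sub_cutPolyM, HERG.cutPoly_sub_cutPolyM]
    refine G.sum_weight_dual_cutTo _ (fun A hA => ?_) fun A hA => .inr (by simpa using hA)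
    rw [Finset.mem_compl] at hA ⊢
    exact fun h' => hA (by simpa using hpair _ h')
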